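/- For a finite group $G$ let $\operatorname{R}(G)$ (respectively $\operatorname{RO}(G)$) denote the Grothendieck group of the commutative monoid of isomorphism classes of finite-dimensional complex (respectively real) representations of $G$ under direct sum. For a subgroup $H\le G$, let $\operatorname{Ind}_H^G$ denote the group homomorphisms $\operatorname{R}(H)\to\operatorname{R}(G)$ and $\operatorname{RO}(H)\to\operatorname{RO}(G)$ given by $U-V\mapsto\operatorname{Ind}_H^G U-\operatorname{Ind}_H^G V$. For $g\in G$ let $(g)_G$ be the conjugacy class of $g$ in $G$ and $(g)_G^{\pm}=(g)_G\cup(g^{-1})_G$ its real conjugacy class; similarly $(h)_H$ and $(h)_H^{\pm}=(h)_H\cup(h^{-1})_H$ for $h\in H$. Let $G$ be a finite group and $H$ a subgroup of $G$. Then: (1) $\operatorname{Ind}_H^G:\operatorname{R}(H)\to\operatorname{R}(G)$ is injective if and only if $(h)_G\cap H=(h)_H$ for every $h\in H$. (2) $\operatorname{Ind}_H^G:\operatorname{RO}(H)\to\operatorname{RO}(G)$ is injective if and only if $(h)_G^{\pm}\cap H=(h)_H^{\pm}$ for every $h\in H$. Moreover, if $H=N$ is normal in $G$, then $\operatorname{Ind}_N^G:\operatorname{R}(N)\to\operatorname{R}(G)$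 is injective if and only if $(n)_G=(n)_N$ for every $n\in N$, and $\operatorname{Ind}_N^G:\operatorname{RO}(N)\to\operatorname{RO}(G)$ is injective if and only if $(n)_G^{\pm}=(n)_N^{\pm}$ for every $n\in N$. -/

import Mathlib

universe u

/-- A finitely generated `kG`-module, i.e. a finite-dimensional `k`-linear representation of `G`. -/
structure FinDimRep (k : Type) [Field k] (G : Type u) [Group G] : Type (u + 1) where
  /-- the underlying vector space -/
  V : Type u
  [addCommGroup : AddCommGroup V]
  [module : Module k V]
  [finite : Module.Finite k V]
  /-- the linear action -/
  ρ : Representation k G V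

namespace FinDimRep

attribute [instance] FinDimRep.addCommGroup FinDimRep.module FinDimRep.finite

variable (k : Type) [Field k] (G : Type u) [Group G]

/-- Two representations are identified when they are isomorphic. -/
instance isoSetoid : Setoid (FinDimRep k G) where
  r A B := Nonempty (A.ρ.Equiv B.ρ)
  iseqv :=
    { refl := fun A => ⟨Representation.Equiv.refl A.ρ⟩
      symm := fun ⟨e⟩ => ⟨e.symm⟩
      trans := fun ⟨e⟩ ⟨f⟩ => ⟨e.trans f⟩ }

variable {k G}

/-- The direct sum `A ⊕ B`. -/
noncomputable def directSum (A B : FinDimRep k G) : FinDimRep k G where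
  V := A.V × B.V
  ρ := A.ρ.prod B.ρ

variable (k G) in
/-- The zero representation. -/
def zero : FinDimRep k G where
  V := PUnit.{u + 1}
  ρ := Representation.trivial k G PUnit.{u + 1}

instance : Unique (zero k G).V := inferInstanceAs (Unique PUnit.{u + 1})

end FinDimRep

/-- The isomorphism classes of finite-dimensional representations of `G` over `k`. -/
def RepClass (k : Type) [Field k] (G : Type u) [Group G] : Type (u + 1) :=
  Quotient (FinDimRep.isoSetoid k G)

namespace RepClass

variable {k : Type} [Field k] {G : Type u} [Group G]

/-- The isomorphism class of a representation. -/
def mk (A : FinDimRep k G) : RepClass k G := Quotient.mk _ A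

instance : Zero (RepClass k G) := ⟨mk (FinDimRep.zero k G)⟩

/-- Addition of isomorphism classes is given by the direct sum. -/
noncomputable instance : Add (RepClass k G) where
  add := Quotient.map₂ FinDimRep.directSum (by
    rintro A A' ⟨e⟩ B B' ⟨f⟩
    refine ⟨Representation.Equiv.mk (e.toLinearEquiv.prodCongr f.toLinearEquiv) fun g => ?_⟩
    refine LinearMap.ext fun x => Prod.ext ?_ ?_
    · exact Representation.IntertwiningMap.isIntertwining _ _ e.toIntertwiningMap g x.1
    · exact Representation.IntertwiningMap.isIntertwining _ _ f.toIntertwiningMap g x.2)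

/-- Isomorphism classes of representations form a commutative monoid under direct sum. -/
noncomputable instance : AddCommMonoid (RepClass k G) where
  add_assoc := by
    rintro ⟨A⟩ ⟨B⟩ ⟨C⟩
    exact Quotient.sound ⟨Representation.Equiv.mk (LinearEquiv.prodAssoc k A.V B.V C.V)
      fun g => rfl⟩
  zero_add := by
    rintro ⟨A⟩
    exact Quotient.sound ⟨Representation.Equiv.mk
      (LinearEquiv.uniqueProd (R := k) (M := A.V) (M₂ := (FinDimRep.zero k G).V)) fun g => rfl⟩
  add_zero := by
    rintro ⟨A⟩
    exact Quotient.sound ⟨Representation.Equiv.mk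
      (LinearEquiv.prodUnique (R := k) (M := A.V) (M₂ := (FinDimRep.zero k G).V)) fun g => rfl⟩
  add_comm := by
    rintro ⟨A⟩ ⟨B⟩
    exact Quotient.sound ⟨Representation.Equiv.mk (LinearEquiv.prodComm k A.V B.V) fun g => rfl⟩
  nsmul := nsmulRec

theorem mk_add_mk (A B : FinDimRep k G) : mk A + mk B = mk (A.directSum B) := rfl

end RepClass

/-- The representation group of `G` over `k`: the Grothendieck group of the monoid of isomorphism
classes of finite-dimensional representations under direct sum. -/
abbrev RepresentationGroup (k : Type) [Field k] (G : Type u) [Group G] : Type (u + 1) :=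
  Algebra.GrothendieckAddGroup (RepClass k G)

/-- The complex representation group `R(G)`. -/
abbrev ComplexRepGroup (G : Type u) [Group G] : Type (u + 1) := RepresentationGroup ℂ G

/-- The real representation group `RO(G)`. -/
abbrev RealRepGroup (G : Type u) [Group G] : Type (u + 1) := RepresentationGroup ℝ G

section Induction

variable {k : Type} [Field k] {G : Type u} [Group G] (H : Subgroup G)

/-- The map `k[G] ⊗_{k[H]} A → k[G] ⊗_{k[H]} B` induced by a homomorphism `A → B` of
representations of `H`. -/
noncomputable def indMapAux {A B : FinDimRep k H} (f : A.ρ.IntertwiningMap B.ρ) :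
    (A.ρ.ind H.subtype).IntertwiningMap (B.ρ.ind H.subtype) where
  toLinearMap := Representation.Coinvariants.map _ _
    (Representation.IntertwiningMap.lTensor
      ((Representation.leftRegular k G).comp H.subtype) f)
  isIntertwining' g := by
    ext
    simp

theorem indMapAux_mk {A B : FinDimRep k H} (f : A.ρ.IntertwiningMap B.ρ) (g : G) (a : A.V) :
    indMapAux H f (Representation.IndV.mk H.subtype A.ρ g a) =
      Representation.IndV.mk H.subtype B.ρ g (f a) := rfl

variable [Finite G]

instance indFiniteAux (A : FinDimRep k H) :
    Module.Finite k (Representation.IndV H.subtype A.ρ) := by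
  have : Module.Finite k (MonoidAlgebra k G) :=
    Module.Finite.equiv (MonoidAlgebra.coeffLinearEquiv (M := G) (S := k) k).symm
  exact Module.Finite.of_surjective (Representation.Coinvariants.mk _)
    (Representation.Coinvariants.mk_surjective _)

/-- The induced representation `Ind_H^G A = k[G] ⊗_{k[H]} A`. -/
noncomputable def FinDimRep.induced (A : FinDimRep k H) : FinDimRep k G where
  V := Representation.IndV H.subtype A.ρ
  ρ := A.ρ.ind H.subtype

/-- Induction on isomorphism classes, as a homomorphism of monoids. -/
noncomputable def RepClass.ind : RepClass k H →+ RepClass k G where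
  toFun := Quotient.map (FinDimRep.induced H) (by
    rintro A B ⟨e⟩
    refine ⟨Representation.Equiv.mk
      (LinearEquiv.ofLinearMap (indMapAux H e.toIntertwiningMap).toLinearMap
        (indMapAux H e.symm.toIntertwiningMap).toLinearMap ?_ ?_)
      (indMapAux H e.toIntertwiningMap).isIntertwining'⟩
    · refine Representation.IndV.hom_ext _ _ fun g => LinearMap.ext fun b => ?_
      change Representation.IndV.mk H.subtype B.ρ g (e (e.symm b)) = _
      rw [e.apply_symm_apply]
      rfl
    · refine Representation.IndV.hom_ext _ _ fun g => LinearMap.ext fun a => ?_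
      change Representation.IndV.mk H.subtype A.ρ g (e.symm (e a)) = _
      rw [e.symm_apply_apply]
      rfl)
  map_zero' := by
    have : Subsingleton (FinDimRep.induced H (FinDimRep.zero k H)).V :=
      (Representation.Coinvariants.mk_surjective
        (Representation.tprod ((Representation.leftRegular k G).comp H.subtype)
          (FinDimRep.zero k H).ρ)).subsingleton
    have : Subsingleton (FinDimRep.zero k G).V := inferInstance
    exact Quotient.sound ⟨Representation.Equiv.mk
      (LinearEquiv.ofSubsingleton _ _) fun g => LinearMap.ext fun x => Subsingleton.elim _ _⟩
  map_add' := by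
    rintro ⟨A⟩ ⟨B⟩
    refine Quotient.sound ⟨Representation.Equiv.mk
      (LinearEquiv.ofLinearMap
        (((indMapAux (A := A.directSum B) (B := A) H
            (Representation.IntertwiningMap.fst k A.ρ B.ρ)).prod
          (indMapAux (A := A.directSum B) (B := B) H
            (Representation.IntertwiningMap.snd k A.ρ B.ρ))).toLinearMap)
        (LinearMap.coprod
          (indMapAux (A := A) (B := A.directSum B) H
            (Representation.IntertwiningMap.inl k A.ρ B.ρ)).toLinearMap
          (indMapAux (A := B) (B := A.directSum B) H
            (Representation.IntertwiningMap.inr k A.ρ B.ρ)).toLinearMap) ?_ ?_)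
      (Representation.IntertwiningMap.isIntertwining' _)⟩
    · refine LinearMap.prod_ext ?_ ?_
      · refine Representation.IndV.hom_ext _ _ fun g => LinearMap.ext fun a => ?_
        change (Representation.IndV.mk H.subtype A.ρ g a,
          Representation.IndV.mk H.subtype B.ρ g 0) = (_, (0 : Representation.IndV H.subtype B.ρ))
        rw [map_zero]
        rfl
      · refine Representation.IndV.hom_ext _ _ fun g => LinearMap.ext fun b => ?_
        change (Representation.IndV.mk H.subtype A.ρ g 0,
          Representation.IndV.mk H.subtype B.ρ g b) = ((0 : Representation.IndV H.subtype A.ρ), _)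
        rw [map_zero]
        rfl
    · refine Representation.IndV.hom_ext _ _ fun g => LinearMap.ext fun x => ?_
      exact (map_add (Representation.IndV.mk H.subtype (A.directSum B).ρ g)
        ((x.1, 0) : A.V × B.V) ((0, x.2) : A.V × B.V)).symm.trans
        (congrArg (Representation.IndV.mk H.subtype (A.directSum B).ρ g)
          (Prod.ext (add_zero x.1) (zero_add x.2)))

/-- The induction homomorphism `Ind_H^G` between representation groups,
`[U] - [V] ↦ [Ind_H^G U] - [Ind_H^G V]`. -/
noncomputable def inductionHom : RepresentationGroup k H →+ RepresentationGroup k G :=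
  Algebra.GrothendieckAddGroup.lift (Algebra.GrothendieckAddGroup.of.comp (RepClass.ind H))

theorem inductionHom_of (A : FinDimRep k H) :
    inductionHom H (Algebra.GrothendieckAddGroup.of (RepClass.mk A)) =
      Algebra.GrothendieckAddGroup.of (RepClass.mk (A.induced H)) := by
  simp [inductionHom, Algebra.GrothendieckAddGroup.lift]
  rfl

end Induction

/-- The real conjugacy class `(g)^± = (g) ∪ (g⁻¹)`. -/
def realConjugatesOf {G : Type u} [Group G] (g : G) : Set G := conjugatesOf g ∪ conjugatesOf g⁻¹

/-!
# Injectivity of induction between representation groups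

Over a field `k` of characteristic zero, induction from `H` to `G` is injective on virtual
representations if and only if every character of `H` is constant on the intersections of `H` with
the conjugacy classes of `G` (`inductionHom_injective_iff_character_eq`).

* A virtual representation is determined by its character, even by the pairings of its character
  with all characters (`eq_zero_of_charForm_eq_zero`); this needs only Maschke's theorem and the
  fact that the pairing of two characters is the dimension of a space of homomorphisms.
* If the characters of `H` are constant on `G`-classes, the formula for the induced character
  (`FinDimRep.character_induced`) shows that the restriction to `H` of an induced virtual character
  is the original one times a function with nonzero values.
* Conversely, by Frobenius reciprocity (`charForm_inducedFunction`) the kernel of induction is the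
  orthogonal complement of the restrictions of characters of `G`. Since the pairing is
  integer-valued on characters, this complement contains a nonzero virtual representation as soon as
  some character of `H` is not a linear combination of restrictions
  (`character_mem_span_of_inductionHom_injective`). Restrictions are constant on `G`-classes.

It remains to see which elements of `H` the characters can tell apart: complex characters separate
conjugacy classes (`isConj_of_complex_character_eq`), and real characters separate exactly the real
conjugacy classes (`isConj_or_isConj_inv_of_character_eq` and `FinDimRep.real_character_inv`). Both
separation results come from `eq_zero_of_sum_mul_character_eq_zero`: a self-adjoint class function
orthogonal to all characters acts by zero on the regular representation.
-/

/-! ### Splitting representations -/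

namespace Representation

variable {k G V W : Type*} [Field k] [Group G] [AddCommGroup V] [Module k V] [AddCommGroup W]
  [Module k W] {ρ : Representation k G V} {σ : Representation k G W}

theorem nonempty_prod_equiv_of_isCompl {U U' : Subrepresentation ρ} (h : IsCompl U U') :
    Nonempty ((U.toRepresentation.prod U'.toRepresentation).Equiv ρ) := by
  have h' : IsCompl U.toSubmodule U'.toSubmodule := by
    refine ⟨disjoint_iff.2 ?_, codisjoint_iff.2 ?_⟩
    · exact congrArg Subrepresentation.toSubmodule (disjoint_iff.1 h.disjoint)
    · exact congrArg Subrepresentation.toSubmodule (codisjoint_iff.1 h.codisjoint)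
  refine ⟨Equiv.mk (Submodule.prodEquivOfIsCompl _ _ h') fun g => LinearMap.ext fun x => ?_⟩
  simp [Subrepresentation.toRepresentation]

/-- A complement of the kernel of `f` is isomorphic to the image of `f`. -/
theorem nonempty_equiv_range_of_isCompl_ker (f : IntertwiningMap ρ σ) {U : Subrepresentation ρ}
    (h : IsCompl f.ker U) : Nonempty (U.toRepresentation.Equiv f.range.toRepresentation) := by
  have hinf : f.ker.toSubmodule ⊓ U.toSubmodule = ⊥ :=
    congrArg Subrepresentation.toSubmodule (disjoint_iff.1 h.disjoint)
  have hsup : f.ker.toSubmodule ⊔ U.toSubmodule = ⊤ :=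
    congrArg Subrepresentation.toSubmodule (codisjoint_iff.1 h.codisjoint)
  let e : U.toSubmodule →ₗ[k] f.range.toSubmodule :=
    (f.toLinearMap.domRestrict U.toSubmodule).codRestrict _ fun x => ⟨x, rfl⟩
  refine ⟨Equiv.mk (LinearEquiv.ofBijective e ⟨?_, ?_⟩) fun g => LinearMap.ext fun x => ?_⟩
  · refine (injective_iff_map_eq_zero e).2 fun x hx => Subtype.ext ?_
    have : (x : V) ∈ f.ker.toSubmodule ⊓ U.toSubmodule := ⟨congrArg Subtype.val hx, x.2⟩
    rw [hinf] at this
    exact this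
  · rintro ⟨_, v, rfl⟩
    have hv : v ∈ f.ker.toSubmodule ⊔ U.toSubmodule := hsup ▸ Submodule.mem_top
    obtain ⟨a, ha, b, hb, rfl⟩ := Submodule.mem_sup.1 hv
    refine ⟨⟨b, hb⟩, Subtype.ext ?_⟩
    have ha' : f.toLinearMap a = 0 := ha
    change f.toLinearMap b = f.toLinearMap (a + b)
    rw [map_add, ha', zero_add]
  · exact Subtype.ext (f.isIntertwining _ _ g x)

theorem character_prod [FiniteDimensional k V] [FiniteDimensional k W] :
    (ρ.prod σ).character = ρ.character + σ.character :=
  funext fun g => LinearMap.trace_prodMap' (ρ g) (σ g)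

end Representation

/-! ### The pairing of characters -/

section CharForm

variable (k : Type*) [Field k] (G : Type*) [Group G] [Fintype G]

/-- The bilinear form `(φ, ψ) ↦ |G|⁻¹ ∑ g, φ g * ψ g⁻¹` on functions `G → k`. -/
noncomputable def charForm : (G → k) →ₗ[k] (G → k) →ₗ[k] k :=
  LinearMap.mk₂ k (fun φ ψ => (Nat.card G : k)⁻¹ * ∑ g, φ g * ψ g⁻¹)
    (fun φ φ' ψ => by simp [add_mul, mul_add, Finset.sum_add_distrib])
    (fun c φ ψ => by simp [Finset.mul_sum]; congr! 1; ring)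
    (fun φ ψ ψ' => by simp [mul_add, Finset.sum_add_distrib])
    (fun c φ ψ => by simp [Finset.mul_sum]; congr! 1; ring)

variable {k G}

theorem charForm_apply (φ ψ : G → k) :
    charForm k G φ ψ = (Nat.card G : k)⁻¹ * ∑ g, φ g * ψ g⁻¹ := rfl

end CharForm

namespace FinDimRep

variable {k : Type} [Field k] {G : Type u} [Group G]

/-- The character of a finite-dimensional representation. -/
noncomputable def character (A : FinDimRep k G) : G → k := A.ρ.character

/-- A subrepresentation as an object of `FinDimRep`. -/
def ofSub {A : FinDimRep k G} (U : Subrepresentation A.ρ) : FinDimRep k G where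
  V := U.toSubmodule
  ρ := U.toRepresentation

/-- The dual representation. -/
noncomputable def dual (A : FinDimRep k G) : FinDimRep k G where
  V := Module.Dual k A.V
  ρ := A.ρ.dual

theorem character_dual (A : FinDimRep k G) (g : G) :
    A.dual.character g = A.character g⁻¹ :=
  Representation.char_dual A.ρ g

theorem character_conj (A : FinDimRep k G) (x g : G) :
    A.character (x * g * x⁻¹) = A.character g :=
  Representation.char_conj A.ρ g x

theorem character_directSum (A B : FinDimRep k G) :
    (A.directSum B).character = A.character + B.character :=
  Representation.character_prod

theorem character_eq_of_equiv {A B : FinDimRep k G} (h : A ≈ B) : A.character = B.character :=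
  let ⟨e⟩ := h
  Representation.char_iso e

theorem directSum_congr {A A' B B' : FinDimRep k G} (h : A ≈ A') (h' : B ≈ B') :
    A.directSum B ≈ A'.directSum B' :=
  Quotient.exact (congrArg₂ (fun x y : RepClass k G => x + y) (Quotient.sound h)
    (Quotient.sound h'))

variable [CharZero k] [Fintype G]

theorem charForm_character (A B : FinDimRep k G) :
    charForm k G A.character B.character =
      Module.finrank k (Representation.IntertwiningMap B.ρ A.ρ) := by
  have : Invertible (Nat.card G : k) := invertibleOfNonzero (by simp [Nat.card_eq_fintype_card])
  exact Representation.card_inv_mul_sum_char_mul_char_eq_finrank B.ρ A.ρ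

instance (A B : FinDimRep k G) : Module.Finite k (Representation.IntertwiningMap A.ρ B.ρ) :=
  Module.Finite.equiv (Representation.invariantsEquivIntertwiningMap A.ρ B.ρ)

/-- By Maschke's theorem, a homomorphism splits off its kernel from its source and its image from
its target. -/
theorem exists_splitting {A B : FinDimRep k G} (f : Representation.IntertwiningMap A.ρ B.ρ) :
    ∃ C : FinDimRep k G, A ≈ (ofSub f.ker).directSum (ofSub f.range) ∧
      B ≈ C.directSum (ofSub f.range) := by
  have : NeZero (Nat.card G : k) := ⟨by simp [Nat.card_eq_fintype_card]⟩
  obtain ⟨U, hU⟩ := exists_isCompl f.ker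
  obtain ⟨C, hC⟩ := exists_isCompl f.range
  refine ⟨ofSub C, ?_, ?_⟩
  · have h1 : (ofSub f.ker).directSum (ofSub U) ≈ A :=
      Representation.nonempty_prod_equiv_of_isCompl hU
    have h2 : ofSub U ≈ ofSub f.range := Representation.nonempty_equiv_range_of_isCompl_ker f hU
    exact Setoid.trans (Setoid.symm h1) (directSum_congr (Setoid.refl _) h2)
  · exact Setoid.symm (Representation.nonempty_prod_equiv_of_isCompl hC.symm)

/-- A representation `A` is determined up to isomorphism by the dimensions of `Hom(C, A)`, that is,
by the pairings of its character with all characters. If there is a nonzero `A → B`, cancel its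
image from both sides; if there is none, the pairings force `Hom(A, A) = 0` and `Hom(B, B) = 0`. -/
theorem equiv_of_charForm_eq (A B : FinDimRep k G)
    (h : ∀ C : FinDimRep k G,
      charForm k G A.character C.character = charForm k G B.character C.character) :
    A ≈ B := by
  induction hn : Module.finrank k A.V using Nat.strong_induction_on generalizing A B with
  | _ n ih =>
  by_cases hf : ∃ f : Representation.IntertwiningMap A.ρ B.ρ, f ≠ 0
  · obtain ⟨f, hf⟩ := hf
    obtain ⟨C, hA, hB⟩ := exists_splitting f
    have hlt : Module.finrank k (ofSub f.ker).V < n := by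
      rw [← hn]
      refine Submodule.finrank_lt (fun htop => hf ?_)
      refine Representation.IntertwiningMap.ext (LinearMap.ext fun x => ?_)
      have : x ∈ f.ker.toSubmodule := htop ▸ Submodule.mem_top
      exact this
    have hC : ofSub f.ker ≈ C := by
      refine ih _ hlt _ _ (fun D => ?_) rfl
      have := h D
      rw [character_eq_of_equiv hA, character_eq_of_equiv hB, character_directSum,
        character_directSum] at this
      simpa using this
    exact Setoid.trans (Setoid.trans hA (directSum_congr hC (Setoid.refl _))) (Setoid.symm hB)
  · push Not at hf
    have key : ∀ D : FinDimRep k G, charForm k G D.character D.character = 0 →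
        Subsingleton D.V := by
      intro D hD
      rw [charForm_character, Nat.cast_eq_zero] at hD
      have := Module.finrank_zero_iff.1 hD
      refine ⟨fun x y => ?_⟩
      have h0 := Subsingleton.elim (Representation.IntertwiningMap.id D.ρ) 0
      rw [← Representation.IntertwiningMap.id_apply D.ρ x,
        ← Representation.IntertwiningMap.id_apply D.ρ y, h0]
      rfl
    have hAA : Subsingleton A.V := by
      refine key A ?_
      rw [h A, charForm_character, Nat.cast_eq_zero]
      exact Module.finrank_zero_iff.2 ⟨fun f g => (hf f).trans (hf g).symm⟩
    have hBB : Subsingleton B.V := by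
      refine key B ?_
      rw [← h B, charForm_character, Nat.cast_eq_zero]
      refine Module.finrank_zero_iff.2 ⟨fun f g => ?_⟩
      exact Representation.IntertwiningMap.ext (LinearMap.ext fun x => Subsingleton.elim _ _)
    exact ⟨Representation.Equiv.mk (LinearEquiv.ofSubsingleton _ _)
      fun g => LinearMap.ext fun x => Subsingleton.elim _ _⟩

end FinDimRep

/-! ### Virtual characters -/

theorem Algebra.GrothendieckAddGroup.mk_eq_of_sub_of {M : Type*} [AddCommMonoid M] (a : M)
    (b : (⊤ : AddSubmonoid M)) :
    (AddLocalization.mk a b : Algebra.GrothendieckAddGroup M) = of a - of b.1 := by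
  have h (m : M) : of m = AddLocalization.mk m 0 :=
    (AddLocalization.mk_zero_eq_addMonoidOf_mk m).symm
  rw [h, h, mk_sub_mk]
  exact congrArg₂ AddLocalization.mk (add_zero _).symm (Subtype.ext (zero_add _).symm)

section VirtualCharacter

variable {k : Type} [Field k] {G : Type u} [Group G]

variable (k G) in
/-- The character as an additive map on isomorphism classes of representations. -/
noncomputable def RepClass.character : RepClass k G →+ (G → k) where
  toFun := Quotient.lift FinDimRep.character fun _ _ h => FinDimRep.character_eq_of_equiv h
  map_zero' := by
    have : Subsingleton (FinDimRep.zero k G).V := inferInstance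
    refine funext fun g => ?_
    change LinearMap.trace k _ ((FinDimRep.zero k G).ρ g) = 0
    rw [show (FinDimRep.zero k G).ρ g = 0 from LinearMap.ext fun x => Subsingleton.elim _ _,
      map_zero]
  map_add' := by
    rintro ⟨A⟩ ⟨B⟩
    exact FinDimRep.character_directSum A B

variable (k G) in
/-- The character of a virtual representation. -/
noncomputable def virtualCharacter : RepresentationGroup k G →+ (G → k) :=
  Algebra.GrothendieckAddGroup.lift (RepClass.character k G)

/-- The class of a representation in the representation group. -/
noncomputable def RepresentationGroup.of (A : FinDimRep k G) : RepresentationGroup k G :=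
  Algebra.GrothendieckAddGroup.of (RepClass.mk A)

theorem virtualCharacter_of (A : FinDimRep k G) :
    virtualCharacter k G (RepresentationGroup.of A) = A.character :=
  DFunLike.congr_fun (Algebra.GrothendieckAddGroup.lift.symm_apply_apply (RepClass.character k G))
    (RepClass.mk A)

theorem RepresentationGroup.exists_eq_sub (x : RepresentationGroup k G) :
    ∃ A B : FinDimRep k G, x = of A - of B := by
  induction x using AddLocalization.ind with
  | _ p =>
    obtain ⟨A, hA⟩ := Quotient.exists_rep p.1
    obtain ⟨B, hB⟩ := Quotient.exists_rep p.2.1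
    refine ⟨A, B, (Algebra.GrothendieckAddGroup.mk_eq_of_sub_of p.1 p.2).trans ?_⟩
    exact congrArg₂
      (fun a b => Algebra.GrothendieckAddGroup.of a - Algebra.GrothendieckAddGroup.of b)
      hA.symm hB.symm

/-- A virtual representation is determined by its pairings with all characters. -/
theorem eq_zero_of_charForm_eq_zero [CharZero k] [Fintype G] (x : RepresentationGroup k G)
    (h : ∀ C : FinDimRep k G, charForm k G (virtualCharacter k G x) C.character = 0) : x = 0 := by
  obtain ⟨A, B, rfl⟩ := x.exists_eq_sub
  have hAB : A ≈ B := FinDimRep.equiv_of_charForm_eq A B fun C => by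
    have := h C
    rwa [map_sub, virtualCharacter_of, virtualCharacter_of, map_sub, LinearMap.sub_apply,
      sub_eq_zero] at this
  rw [sub_eq_zero]
  exact congrArg Algebra.GrothendieckAddGroup.of (Quotient.sound hAB)

end VirtualCharacter

/-! ### Induced characters and Frobenius reciprocity -/

section InducedFunction

variable {k : Type*} [Field k] {G : Type*} [Group G] [Fintype G] (H : Subgroup G) [Fintype H]

open Classical in
/-- The induction of a function `φ : H → k` to `G`:
`g ↦ |H|⁻¹ ∑ φ (x * g * x⁻¹)`, over those `x : G` with `x * g * x⁻¹ ∈ H`. The sum is over all pairs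
`(x, h)` with `h * x = x * g`. -/
noncomputable def inducedFunction : (H → k) →ₗ[k] (G → k) where
  toFun φ g := (Nat.card H : k)⁻¹ * ∑ h : H, ∑ x : G, if h * x = x * g then φ h else 0
  map_add' φ ψ := by
    funext g
    rw [Pi.add_apply, ← mul_add, ← Finset.sum_add_distrib]
    congr 1
    refine Finset.sum_congr rfl fun h _ => ?_
    rw [← Finset.sum_add_distrib]
    refine Finset.sum_congr rfl fun x _ => ?_
    split_ifs <;> simp
  map_smul' c φ := by
    funext g
    simp only [Pi.smul_apply, smul_eq_mul, RingHom.id_apply, ← mul_ite_zero, ← Finset.mul_sum]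
    ring

open Classical in
theorem inducedFunction_apply (φ : H → k) (g : G) :
    inducedFunction H φ g =
      (Nat.card H : k)⁻¹ * ∑ h : H, ∑ x : G, if h * x = x * g then φ h else 0 := rfl

/-- Frobenius reciprocity for functions. -/
theorem charForm_inducedFunction (φ : H → k) {ψ : G → k} (hψ : ∀ x g, ψ (x * g * x⁻¹) = ψ g)
    [CharZero k] :
    charForm k G (inducedFunction H φ) ψ = charForm k H φ (fun h => ψ h) := by
  classical
  have hG : (Nat.card G : k) ≠ 0 := by simp [Nat.card_eq_fintype_card]
  have key : ∀ h : H, ∑ g : G, ∑ x : G, (if h * x = x * g then φ h else 0) * ψ g⁻¹ =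
      Nat.card G * (φ h * ψ (h⁻¹ : H)) := by
    intro h
    rw [Finset.sum_comm, Nat.card_eq_fintype_card, ← nsmul_eq_mul, ← Finset.card_univ,
      ← Finset.sum_const]
    refine Finset.sum_congr rfl fun x _ => ?_
    rw [Finset.sum_eq_single (x⁻¹ * h * x)]
    · rw [if_pos (by group)]
      congr 1
      rw [← hψ x]
      congr 1
      push_cast
      group
    · intro g _ hg
      rw [if_neg, zero_mul]
      rintro hg'
      exact hg (by rw [mul_assoc, hg']; group)
    · simp
  calc charForm k G (inducedFunction H φ) ψ
      = (Nat.card G : k)⁻¹ * ((Nat.card H : k)⁻¹ *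
          ∑ h : H, ∑ g : G, ∑ x : G, (if h * x = x * g then φ h else 0) * ψ g⁻¹) := by
        rw [charForm_apply]
        congr 1
        rw [Finset.sum_comm, Finset.mul_sum]
        refine Finset.sum_congr rfl fun g _ => ?_
        rw [inducedFunction_apply, mul_assoc]
        simp only [Finset.sum_mul]
    _ = charForm k H φ (fun h => ψ h) := by
        simp only [key, ← Finset.mul_sum]
        rw [charForm_apply]
        field_simp

end InducedFunction

namespace Representation

/-- The trace on the coinvariants of a finite group is the trace of the composite with the
projector `|G|⁻¹ ∑ g, ρ g`. -/
theorem trace_coinvariants_map {k G V : Type*} [Field k] [CharZero k] [Group G] [Fintype G]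
    [AddCommGroup V] [Module k V] [FiniteDimensional k V] (ρ : Representation k G V)
    (f : IntertwiningMap ρ ρ) :
    LinearMap.trace k _ (Coinvariants.map ρ ρ f) =
      (Nat.card G : k)⁻¹ * ∑ g, LinearMap.trace k V (f.toLinearMap ∘ₗ ρ g) := by
  have hG : (Nat.card G : k) ≠ 0 := by simp [Nat.card_eq_fintype_card]
  have : Module.Finite k (Coinvariants ρ) :=
    Module.Finite.of_surjective (Coinvariants.mk ρ) (Coinvariants.mk_surjective ρ)
  let s : Coinvariants ρ →ₗ[k] V :=
    Coinvariants.lift ρ ((Nat.card G : k)⁻¹ • ρ.norm) fun g => by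
      rw [LinearMap.smul_comp, norm_comp_self]
  have hs : Coinvariants.mk ρ ∘ₗ s = LinearMap.id := by
    refine Coinvariants.hom_ext (LinearMap.ext fun x => ?_)
    change Coinvariants.mk ρ ((Nat.card G : k)⁻¹ • ρ.norm x) = Coinvariants.mk ρ x
    simp only [norm, LinearMap.sum_apply, map_smul, map_sum, Coinvariants.mk_self_apply,
      Finset.sum_const, Finset.card_univ, ← Nat.card_eq_fintype_card]
    rw [← Nat.cast_smul_eq_nsmul k, smul_smul, inv_mul_cancel₀ hG, one_smul]
  calc LinearMap.trace k _ (Coinvariants.map ρ ρ f)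
      = LinearMap.trace k _ ((Coinvariants.map ρ ρ f ∘ₗ Coinvariants.mk ρ) ∘ₗ s) := by
        rw [LinearMap.comp_assoc, hs, LinearMap.comp_id]
    _ = LinearMap.trace k _ ((f.toLinearMap ∘ₗ s) ∘ₗ Coinvariants.mk ρ) := by
        rw [Coinvariants.map_comp_mk, LinearMap.comp_assoc, LinearMap.trace_comp_comm']
        rfl
    _ = LinearMap.trace k _ (f.toLinearMap ∘ₗ ((Nat.card G : k)⁻¹ • ρ.norm)) := by
        rw [LinearMap.comp_assoc, Coinvariants.lift_comp_mk]
    _ = _ := by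
        rw [LinearMap.comp_smul, map_smul, smul_eq_mul, norm]
        simp only [← Module.End.mul_eq_comp, Finset.mul_sum (f := fun g => ρ g), map_sum]

open Classical in
theorem trace_mapDomain {k G : Type*} [Field k] [Fintype G] (f : G → G) :
    LinearMap.trace k (MonoidAlgebra k G) (MonoidAlgebra.mapDomainLinearMap k k f) =
      ∑ x, if f x = x then 1 else 0 := by
  rw [LinearMap.trace_eq_matrix_trace k
    (Module.Basis.ofRepr (MonoidAlgebra.coeffLinearEquiv (M := G) (S := k) k)), Matrix.trace]
  refine Finset.sum_congr rfl fun x _ => ?_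
  simp [LinearMap.toMatrix_apply, Finsupp.single_apply]

end Representation

namespace FinDimRep

variable {k : Type} [Field k] [CharZero k] {G : Type u} [Group G] [Fintype G] (H : Subgroup G)
  [Fintype H]

/-- The induced representation is the space of coinvariants of `H` on `k[G] ⊗ A`, so its character
is an average over `H` of traces on `k[G] ⊗ A`, each of which is a product of traces. -/
theorem character_induced (A : FinDimRep k H) :
    (A.induced H).character = inducedFunction H A.character := by
  classical
  funext g
  rw [inducedFunction_apply]
  have : Module.Finite k (MonoidAlgebra k G) :=
    Module.Finite.equiv (MonoidAlgebra.coeffLinearEquiv (M := G) (S := k) k).symm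
  refine (Representation.trace_coinvariants_map _ _).trans ?_
  congr 1
  refine Finset.sum_congr rfl fun h _ => ?_
  have hmap : (MonoidAlgebra.mapDomainLinearMap k k fun x : G => x * g⁻¹).rTensor A.V ∘ₗ
      Representation.tprod ((Representation.leftRegular k G).comp H.subtype) A.ρ h =
      TensorProduct.map (MonoidAlgebra.mapDomainLinearMap k k fun x : G => h * x * g⁻¹)
        (A.ρ h) := by
    ext
    simp
  refine (congrArg _ hmap).trans ?_
  rw [LinearMap.trace_tensorProduct', Representation.trace_mapDomain, Finset.sum_mul]
  refine Finset.sum_congr rfl fun x _ => ?_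
  simp only [mul_inv_eq_iff_eq_mul, ite_mul, one_mul, zero_mul]
  rfl

end FinDimRep

section VirtualCharacter

variable {k : Type} [Field k] [CharZero k] {G : Type u} [Group G] [Fintype G] (H : Subgroup G)
  [Fintype H]

theorem virtualCharacter_inductionHom (x : RepresentationGroup k H) :
    virtualCharacter k G (inductionHom H x) = inducedFunction H (virtualCharacter k H x) := by
  obtain ⟨A, B, rfl⟩ := x.exists_eq_sub
  have h (A : FinDimRep k H) : inductionHom H (RepresentationGroup.of A) =
    RepresentationGroup.of (A.induced H) := inductionHom_of H A
  simp only [map_sub, h, virtualCharacter_of, FinDimRep.character_induced]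

end VirtualCharacter

/-! ### Separation of conjugacy classes by characters -/

section Separation

variable {k : Type} [RCLike k] {G : Type u} [Group G]

variable (k G) in
/-- The left regular representation on the Hilbert space `EuclideanSpace k G`. -/
noncomputable def euclideanRegular : Representation k G (EuclideanSpace k G) where
  toFun g :=
    { toFun := fun v => WithLp.toLp 2 fun x => v (g⁻¹ * x)
      map_add' := fun _ _ => rfl
      map_smul' := fun _ _ => rfl }
  map_one' := by ext; simp
  map_mul' g h := by
    ext v x
    change v ((g * h)⁻¹ * x) = v (h⁻¹ * (g⁻¹ * x))
    rw [mul_inv_rev, mul_assoc]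

theorem euclideanRegular_apply (g : G) (v : EuclideanSpace k G) (x : G) :
    euclideanRegular k G g v x = v (g⁻¹ * x) := rfl

variable [Fintype G]

theorem inner_euclideanRegular (g : G) (v w : EuclideanSpace k G) :
    inner k (euclideanRegular k G g v) w = inner k v (euclideanRegular k G g⁻¹ w) := by
  rw [PiLp.inner_apply, PiLp.inner_apply]
  refine Fintype.sum_equiv (Equiv.mulLeft g⁻¹) _ _ fun x => ?_
  simp [euclideanRegular_apply]

/-- A class function `f` with `f y⁻¹ = conj (f y)` which pairs to zero with all characters is zero.
It acts on the regular representation by a self-adjoint operator; each eigenspace is a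
subrepresentation, on which the trace is both zero and the eigenvalue times the dimension. -/
theorem eq_zero_of_sum_mul_character_eq_zero (f : G → k) (hconj : ∀ x y, f (x * y * x⁻¹) = f y)
    (hstar : ∀ y, f y⁻¹ = star (f y))
    (hf : ∀ A : FinDimRep k G, ∑ y, f y * A.character y = 0) : f = 0 := by
  classical
  set ρ := euclideanRegular k G
  let A : FinDimRep k G := ⟨EuclideanSpace k G, ρ⟩
  let T : EuclideanSpace k G →ₗ[k] EuclideanSpace k G := ∑ y, f y • ρ y
  have hTapp (v : EuclideanSpace k G) : T v = ∑ y, f y • ρ y v := by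
    simp [T, LinearMap.sum_apply]
  have hcomm (g : G) (v : EuclideanSpace k G) : T (ρ g v) = ρ g (T v) := by
    rw [hTapp, hTapp, map_sum]
    refine Fintype.sum_equiv (MulAut.conj g⁻¹).toEquiv _ _ fun y => ?_
    rw [map_smul, ← Module.End.mul_apply, ← Module.End.mul_apply, ← map_mul, ← map_mul]
    have hy : MulAut.conj g⁻¹ y = g⁻¹ * y * g := by simp
    have hfy : f (g⁻¹ * y * g) = f y := by simpa using hconj g⁻¹ y
    change _ = f (MulAut.conj g⁻¹ y) • ρ (g * MulAut.conj g⁻¹ y) v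
    rw [hy, hfy, mul_assoc, mul_inv_cancel_left]
  have hsymm : T.IsSymmetric := by
    intro v w
    rw [hTapp, hTapp, sum_inner, inner_sum]
    refine Fintype.sum_equiv (Equiv.inv G) _ _ fun y => ?_
    rw [inner_smul_left, inner_smul_right, inner_euclideanRegular, Equiv.inv_apply, hstar]
    rfl
  have heig (μ : k) (v : EuclideanSpace k G) (hv : T v = μ • v) (hv0 : v ≠ 0) : μ = 0 := by
    let U : Subrepresentation A.ρ :=
      { toSubmodule := Module.End.eigenspace T μ
        apply_mem_toSubmodule := fun g w hw => by
          rw [Module.End.mem_eigenspace_iff] at hw ⊢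
          exact (hcomm g w).trans (by rw [hw, map_smul]) }
    have htr : ∑ y, f y • U.toRepresentation y = μ • LinearMap.id := by
      refine LinearMap.ext fun w => Subtype.ext ?_
      have hw : T w = μ • (w : EuclideanSpace k G) := Module.End.mem_eigenspace_iff.1 w.2
      rw [hTapp] at hw
      simpa [LinearMap.sum_apply, Subrepresentation.toRepresentation] using hw
    have h1 := congrArg (LinearMap.trace k U.toSubmodule) htr
    simp only [map_sum, map_smul, smul_eq_mul, LinearMap.trace_id] at h1
    have h2 : μ * (Module.finrank k U.toSubmodule : k) = 0 := h1.symm.trans (hf (.ofSub U))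
    refine (mul_eq_zero.1 h2).resolve_right fun h3 => hv0 ?_
    rw [Nat.cast_eq_zero, Submodule.finrank_eq_zero] at h3
    have : v ∈ U.toSubmodule := Module.End.mem_eigenspace_iff.2 hv
    rw [h3] at this
    exact this
  have hT0 : T = 0 := by
    refine (hsymm.eigenvectorBasis rfl).toBasis.ext fun i => ?_
    have h1 := hsymm.apply_eigenvectorBasis rfl i
    have h2 := heig _ _ h1 ((hsymm.eigenvectorBasis rfl).orthonormal.ne_zero i)
    simp [h1, h2]
  funext y
  have h1 := congrArg (fun v : EuclideanSpace k G => v y)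
    ((hTapp (EuclideanSpace.single 1 1)).symm.trans (LinearMap.congr_fun hT0 _))
  simpa [ρ, euclideanRegular_apply, inv_mul_eq_one, Pi.single_apply] using h1

end Separation

section ClassIndicator

variable {G : Type*} [Group G] [Fintype G]

open Classical in
/-- The number of `x` with `x * g * x⁻¹ = y`, a multiple of the indicator function of the conjugacy
class of `g`. -/
noncomputable def conjCount (g y : G) : ℕ := ∑ x : G, if x * g * x⁻¹ = y then 1 else 0

theorem conjCount_conj (g z y : G) : conjCount g (z * y * z⁻¹) = conjCount g y := by
  refine Fintype.sum_equiv (Equiv.mulLeft z⁻¹) _ _ fun x => ?_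
  congr 1
  rw [Equiv.coe_mulLeft, eq_iff_iff, eq_mul_inv_iff_mul_eq, ← inv_mul_eq_iff_eq_mul]
  simp [mul_assoc]

theorem conjCount_ne_zero_iff {g y : G} : conjCount g y ≠ 0 ↔ IsConj g y := by
  simp [conjCount, isConj_iff]

theorem sum_conjCount_mul {k : Type*} [CommSemiring k] (g : G) {φ : G → k}
    (hφ : ∀ x y, φ (x * y * x⁻¹) = φ y) :
    ∑ y, (conjCount g y : k) * φ y = Nat.card G * φ g := by
  classical
  simp only [conjCount, Nat.cast_sum, Finset.sum_mul]
  rw [Finset.sum_comm]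
  simp [hφ, Nat.card_eq_fintype_card]

end ClassIndicator

section Separation

variable {k : Type} [RCLike k] {G : Type u} [Group G] [Fintype G]

theorem sum_conjCount_sub_mul_character {g h : G}
    (hgh : ∀ A : FinDimRep k G, A.character g = A.character h) (A : FinDimRep k G) :
    ∑ y, ((conjCount g y : k) - conjCount h y) * A.character y = 0 := by
  simp only [sub_mul, Finset.sum_sub_distrib, sum_conjCount_mul _ A.character_conj, hgh, sub_self]

theorem sum_conjCount_inv_sub_mul_character {g h : G}
    (hgh : ∀ A : FinDimRep k G, A.character g = A.character h) (A : FinDimRep k G) :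
    ∑ y, ((conjCount g y⁻¹ : k) - conjCount h y⁻¹) * A.character y = 0 := by
  rw [← sum_conjCount_sub_mul_character hgh A.dual]
  refine Fintype.sum_equiv (Equiv.inv G) _ _ fun y => ?_
  rw [Equiv.inv_apply, A.character_dual, inv_inv]

theorem conjCount_inv_conj (g x y : G) : conjCount g (x * y * x⁻¹)⁻¹ = conjCount g y⁻¹ := by
  rw [← conjCount_conj g x y⁻¹]
  group

/-- The difference of the class indicators of `g` and `h`, symmetrized under inversion, is a
self-adjoint class function which is orthogonal to all characters, hence zero. -/
theorem conjCount_add_conjCount_inv {g h : G}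
    (hgh : ∀ A : FinDimRep k G, A.character g = A.character h) (y : G) :
    conjCount g y + conjCount g y⁻¹ = conjCount h y + conjCount h y⁻¹ := by
  have := eq_zero_of_sum_mul_character_eq_zero (k := k)
    (fun y => ((conjCount g y : k) - conjCount h y) + ((conjCount g y⁻¹ : k) - conjCount h y⁻¹))
    (fun x y => by simp only [conjCount_conj, conjCount_inv_conj])
    (fun y => by simp [add_comm])
    (fun A => by
      simp only [add_mul, Finset.sum_add_distrib]
      rw [sum_conjCount_sub_mul_character hgh, sum_conjCount_inv_sub_mul_character hgh, add_zero])
  have hy := congrFun this y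
  rw [Pi.zero_apply] at hy
  have : (conjCount g y + conjCount g y⁻¹ : k) = conjCount h y + conjCount h y⁻¹ := by
    linear_combination hy
  exact_mod_cast this

/-- Over `ℝ` and over `ℂ`, characters separate real conjugacy classes. -/
theorem isConj_or_isConj_inv_of_character_eq {g h : G}
    (hgh : ∀ A : FinDimRep k G, A.character g = A.character h) :
    IsConj h g ∨ IsConj h g⁻¹ := by
  rw [← conjCount_ne_zero_iff, ← conjCount_ne_zero_iff]
  have h1 := conjCount_add_conjCount_inv hgh g
  have h2 : conjCount g g ≠ 0 := conjCount_ne_zero_iff.2 (IsConj.refl g)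
  omega

/-- Characters of complex representations separate conjugacy classes. -/
theorem isConj_of_complex_character_eq {g h : G}
    (hgh : ∀ A : FinDimRep ℂ G, A.character g = A.character h) : IsConj h g := by
  -- Multiplying the part that is antisymmetric under inversion by `I` makes it self-adjoint.
  have := eq_zero_of_sum_mul_character_eq_zero (k := ℂ)
    (fun y => Complex.I *
      (((conjCount g y : ℂ) - conjCount h y) - ((conjCount g y⁻¹ : ℂ) - conjCount h y⁻¹)))
    (fun x y => by simp only [conjCount_conj, conjCount_inv_conj])
    (fun y => by simp; ring)
    (fun A => by
      have h1 := sum_conjCount_sub_mul_character hgh A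
      have h2 := sum_conjCount_inv_sub_mul_character hgh A
      refine Eq.trans ?_ (show Complex.I * (0 - 0) = 0 by simp)
      nth_rw 1 [← h1]
      rw [← h2, ← Finset.sum_sub_distrib, Finset.mul_sum]
      exact Finset.sum_congr rfl fun y _ => by ring)
  have hy := (mul_eq_zero.1 (congrFun this g)).resolve_left Complex.I_ne_zero
  have h1 : conjCount g g + conjCount h g⁻¹ = conjCount h g + conjCount g g⁻¹ := by
    have : (conjCount g g + conjCount h g⁻¹ : ℂ) = conjCount h g + conjCount g g⁻¹ := by
      linear_combination hy
    exact_mod_cast this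
  have h2 := conjCount_add_conjCount_inv hgh g
  have h3 : conjCount g g ≠ 0 := conjCount_ne_zero_iff.2 (IsConj.refl g)
  rw [← conjCount_ne_zero_iff]
  omega

end Separation

/-- A real representation is isomorphic to its dual through an invariant inner product. -/
theorem FinDimRep.real_character_inv {G : Type u} [Group G] [Finite G] (A : FinDimRep ℝ G) (g : G) :
    A.character g⁻¹ = A.character g := by
  cases nonempty_fintype G
  let b := Module.finBasis ℝ A.V
  let B : A.V →ₗ[ℝ] Module.Dual ℝ A.V := ∑ x, Representation.linHom A.ρ A.ρ.dual x b.toDual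
  have hBapp (v w : A.V) : B v w = ∑ x, b.toDual (A.ρ x⁻¹ v) (A.ρ x⁻¹ w) := by
    simp [B, LinearMap.sum_apply, Module.Dual.transpose]
  have hb (v : A.V) : b.toDual v v = ∑ i, b.repr v i ^ 2 := by
    calc b.toDual v v = b.toDual v (∑ i, b.repr v i • b i) := by rw [b.sum_repr]
      _ = _ := by simp only [map_sum, map_smul, b.toDual_eq_repr, smul_eq_mul, sq]
  have hinj : Function.Injective B := by
    refine (injective_iff_map_eq_zero B).2 fun v hv => ?_
    have h0 := hBapp v v
    rw [hv, LinearMap.zero_apply] at h0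
    have h1 := (Finset.sum_eq_zero_iff_of_nonneg fun x _ => by rw [hb]; positivity).1 h0.symm 1
      (Finset.mem_univ _)
    rw [hb] at h1
    have h2 := (Finset.sum_eq_zero_iff_of_nonneg fun i _ => by positivity).1 h1
    refine b.repr.map_eq_zero_iff.1 (Finsupp.ext fun i => ?_)
    simpa using h2 i (Finset.mem_univ _)
  refine (Representation.char_dual A.ρ g).symm.trans ?_
  refine congrFun (Representation.char_iso (Representation.Equiv.mk (B.linearEquivOfInjective hinj
    Subspace.dual_finrank_eq.symm) fun g => LinearMap.ext fun v => LinearMap.ext fun w => ?_)).symm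
    g
  change B (A.ρ g v) w = B v (A.ρ g⁻¹ w)
  rw [hBapp, hBapp]
  refine Fintype.sum_equiv (Equiv.mulLeft g⁻¹) _ _ fun x => ?_
  simp

/-! ### Injectivity of induction and fusion of characters -/

/-- The restriction of a representation of `G` to the subgroup `H`. -/
def FinDimRep.restrict {k : Type} [Field k] {G : Type u} [Group G] (H : Subgroup G)
    (A : FinDimRep k G) : FinDimRep k H where
  V := A.V
  ρ := A.ρ.comp H.subtype

section VirtualCharacter

variable {k : Type} [Field k] [CharZero k] {G : Type u} [Group G] [Fintype G] (H : Subgroup G)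
  [Fintype H]

/-- If the characters of `H` are constant on the classes of `G`, then `|H|` times the character of
an induced virtual representation at `h₀ : H` is a positive multiple of the character of the given
one at `h₀`. -/
theorem inductionHom_injective_of_character_eq
    (hH : ∀ (A : FinDimRep k H) (h h' : H), IsConj (h : G) h' → A.character h = A.character h') :
    Function.Injective (inductionHom H : RepresentationGroup k H →+ RepresentationGroup k G) := by
  classical
  rw [injective_iff_map_eq_zero]
  intro x hx
  have hx' : inducedFunction H (virtualCharacter k H x) = 0 := by
    rw [← virtualCharacter_inductionHom, hx, map_zero]
  have hconj : ∀ h h' : H, IsConj (h : G) h' →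
      virtualCharacter k H x h = virtualCharacter k H x h' := by
    intro h h' hh
    obtain ⟨A, B, rfl⟩ := x.exists_eq_sub
    simp [virtualCharacter_of, hH _ h h' hh]
  suffices h0 : virtualCharacter k H x = 0 from
    eq_zero_of_charForm_eq_zero x fun C => by rw [h0, map_zero, LinearMap.zero_apply]
  funext h₀
  have h1 : ∑ h : H, ∑ y : G, (if (h : G) * y = y * h₀ then virtualCharacter k H x h else 0) =
      (∑ h : H, ∑ y : G, (if (h : G) * y = y * h₀ then 1 else 0) : ℕ) *
        virtualCharacter k H x h₀ := by
    push_cast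
    simp only [Finset.sum_mul]
    refine Finset.sum_congr rfl fun h _ => Finset.sum_congr rfl fun y _ => ?_
    split_ifs with hy
    · rw [one_mul]
      exact hconj h h₀ (isConj_iff.2 ⟨y⁻¹, by rw [mul_assoc, inv_inv, hy]; group⟩)
    · rw [zero_mul]
  have h2 := congrFun hx' h₀
  rw [inducedFunction_apply, h1, Pi.zero_apply, mul_eq_zero, mul_eq_zero, Nat.cast_eq_zero] at h2
  refine (h2.resolve_left (by simp [Nat.card_eq_fintype_card])).resolve_left fun h3 => ?_
  -- The pair `(1, h₀)` satisfies `h₀ * 1 = 1 * h₀`, so the multiplicity is positive.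
  have h4 := Finset.sum_eq_zero_iff.1 (Finset.sum_eq_zero_iff.1 h3 h₀ (Finset.mem_univ _)) 1
    (Finset.mem_univ _)
  simp at h4

/-- If induction is injective, then the characters of `H` lie in the `k`-span of the restrictions
of characters of `G`. Otherwise take a basis of that span made of restricted characters and add a
character outside of it: the Gram matrix between the basis and the enlarged family is an integer
matrix with more columns than rows, so it kills a nonzero integer vector. This vector defines a
nonzero virtual representation of `H` which is orthogonal to all restrictions, and whose induction
vanishes by Frobenius reciprocity. -/
theorem character_mem_span_of_inductionHom_injective
    (hinj : Function.Injective
      (inductionHom H : RepresentationGroup k H →+ RepresentationGroup k G))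
    (B : FinDimRep k H) :
    B.character ∈ Submodule.span k
      (Set.range fun A : FinDimRep k G => (A.restrict H).character) := by
  by_contra hB
  obtain ⟨b, hbs, hspan, hli⟩ := exists_linearIndependent k
    (Set.range fun A : FinDimRep k G => (A.restrict H).character)
  have : Fintype b := (LinearIndependent.setFinite hli).fintype
  have hD : ∀ o : Option b, ∃ D : FinDimRep k H,
      D.character = Option.casesOn' o B.character ((↑) : b → H → k) := by
    rintro (_ | i)
    · exact ⟨B, rfl⟩
    · obtain ⟨A, hA⟩ := hbs i.2
      exact ⟨A.restrict H, hA⟩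
  choose D hD using hD
  have hliD : LinearIndependent k fun o => (D o).character := by
    simp only [hD]
    refine linearIndependent_option'.2 ⟨hli, ?_⟩
    rwa [Subtype.range_coe, hspan]
  let N : Matrix b (Option b) ℤ := fun i o =>
    Module.finrank k (Representation.IntertwiningMap (D i).ρ (D o).ρ)
  -- `N` has one more column than rows.
  have hN : ¬ Function.Injective N.mulVecLin := fun h => by
    simpa using card_le_of_injective ℤ _ h
  obtain ⟨c, hc, hc0⟩ : ∃ c, N.mulVec c = 0 ∧ c ≠ 0 := by
    simpa [injective_iff_map_eq_zero] using hN
  let x : RepresentationGroup k H := ∑ o, c o • RepresentationGroup.of (D o)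
  have hx : virtualCharacter k H x = ∑ o, (c o : k) • (D o).character := by
    simp only [x, map_sum, map_zsmul, virtualCharacter_of, Int.cast_smul_eq_zsmul]
  have horth : Submodule.span k (Set.range fun A : FinDimRep k G => (A.restrict H).character) ≤
      LinearMap.ker (charForm k H (virtualCharacter k H x)) := by
    rw [← hspan, Submodule.span_le]
    intro v hv
    have hi : v = (D (some ⟨v, hv⟩)).character := (hD (some ⟨v, hv⟩)).symm
    have hci := congrArg (Int.cast : ℤ → k) (congrFun hc ⟨v, hv⟩)
    rw [SetLike.mem_coe, LinearMap.mem_ker, hi, hx, map_sum, LinearMap.sum_apply]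
    simp only [map_smul, LinearMap.smul_apply, FinDimRep.charForm_character]
    simpa [Matrix.mulVec, dotProduct, N, mul_comm] using hci
  have hx0 : x = 0 := by
    refine (injective_iff_map_eq_zero _).1 hinj x (eq_zero_of_charForm_eq_zero _ fun C => ?_)
    rw [virtualCharacter_inductionHom, charForm_inducedFunction H _ C.character_conj]
    exact horth (Submodule.subset_span ⟨C, rfl⟩)
  rw [hx0, map_zero] at hx
  exact hc0 (funext fun o => by
    exact_mod_cast Fintype.linearIndependent_iff.1 hliD (fun o => (c o : k)) hx.symm o)

/-- Over any field of characteristic zero, induction is injective if and only if all characters of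
`H` are constant on the elements of `H` that are conjugate in `G`. -/
theorem inductionHom_injective_iff_character_eq :
    Function.Injective (inductionHom H : RepresentationGroup k H →+ RepresentationGroup k G) ↔
      ∀ (A : FinDimRep k H) (h h' : H), IsConj (h : G) h' → A.character h = A.character h' := by
  refine ⟨fun hinj A h h' hh => ?_, inductionHom_injective_of_character_eq H⟩
  have hspan : Submodule.span k (Set.range fun A : FinDimRep k G => (A.restrict H).character) ≤
      LinearMap.ker (LinearMap.proj (R := k) (φ := fun _ : H => k) h - LinearMap.proj h') := by
    rw [Submodule.span_le]
    rintro _ ⟨C, rfl⟩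
    obtain ⟨g, hg⟩ := isConj_iff.1 hh
    refine sub_eq_zero.2 ?_
    change C.character h = C.character h'
    rw [← hg, C.character_conj]
  exact sub_eq_zero.1 (hspan (character_mem_span_of_inductionHom_injective H hinj A))

end VirtualCharacter

/-! ### Injectivity of induction and fusion of conjugacy classes -/

section Fusion

variable {G : Type u} [Group G]

theorem conjugatesOf_subset_of_normal {H : Subgroup G} (hH : H.Normal) (h : H) :
    conjugatesOf (h : G) ⊆ H := by
  intro x hx
  obtain ⟨z, rfl⟩ := isConj_iff.1 hx
  exact hH.conj_mem h h.2 z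

theorem realConjugatesOf_subset_of_normal {H : Subgroup G} (hH : H.Normal) (h : H) :
    realConjugatesOf (h : G) ⊆ H :=
  Set.union_subset (conjugatesOf_subset_of_normal hH h) (conjugatesOf_subset_of_normal hH h⁻¹)

variable [Finite G] (H : Subgroup G)

theorem complex_inductionHom_injective_iff :
    Function.Injective (inductionHom H : ComplexRepGroup H →+ ComplexRepGroup G) ↔
      ∀ h : H, conjugatesOf (h : G) ∩ (H : Set G) = Subtype.val '' conjugatesOf h := by
  cases nonempty_fintype G
  have := Fintype.ofFinite H
  rw [inductionHom_injective_iff_character_eq]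
  constructor
  · refine fun hH h => Set.Subset.antisymm ?_ ?_
    · rintro x ⟨hx, hxH⟩
      exact ⟨⟨x, hxH⟩, isConj_of_complex_character_eq fun A => (hH A h ⟨x, hxH⟩ hx).symm, rfl⟩
    · rintro _ ⟨x, hx, rfl⟩
      exact ⟨H.subtype.map_isConj hx, x.2⟩
  · intro hH A h h' hh
    obtain ⟨y, hy, hyh⟩ := (hH h).subset ⟨hh, h'.2⟩
    obtain ⟨z, hz⟩ := isConj_iff.1 (show IsConj h y from hy)
    rw [← Subtype.ext hyh, ← hz, A.character_conj]

theorem real_inductionHom_injective_iff :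
    Function.Injective (inductionHom H : RealRepGroup H →+ RealRepGroup G) ↔
      ∀ h : H, realConjugatesOf (h : G) ∩ (H : Set G) = Subtype.val '' realConjugatesOf h := by
  cases nonempty_fintype G
  have := Fintype.ofFinite H
  rw [inductionHom_injective_iff_character_eq]
  constructor
  · refine fun hH h => Set.Subset.antisymm ?_ ?_
    · rintro x ⟨hx, hxH⟩
      refine ⟨⟨x, hxH⟩, ?_, rfl⟩
      have hchar : ∀ A : FinDimRep ℝ H, A.character ⟨x, hxH⟩ = A.character h := fun A => by
        rcases hx with hx | hx
        · exact (hH A h ⟨x, hxH⟩ hx).symm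
        · rw [← hH A h⁻¹ ⟨x, hxH⟩ hx, A.real_character_inv]
      rcases isConj_or_isConj_inv_of_character_eq hchar with hc | hc
      · exact Or.inl hc
      · refine Or.inr ?_
        obtain ⟨z, hz⟩ := isConj_iff.1 hc
        exact isConj_iff.2 ⟨z, by rw [← conj_inv, hz, inv_inv]⟩
    · rintro _ ⟨x, hx | hx, rfl⟩
      · exact ⟨Or.inl (H.subtype.map_isConj hx), x.2⟩
      · exact ⟨Or.inr (H.subtype.map_isConj hx), x.2⟩
  · intro hH A h h' hh
    obtain ⟨y, hy, hyh⟩ := (hH h).subset ⟨Or.inl hh, h'.2⟩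
    rw [← Subtype.ext hyh]
    rcases hy with hy | hy <;> obtain ⟨z, hz⟩ := isConj_iff.1 hy
    · rw [← hz, A.character_conj]
    · rw [← hz, A.character_conj, A.real_character_inv]

end Fusion

theorem theoremA {G : Type u} [Group G] [Finite G] (H : Subgroup G) :
    (Function.Injective (inductionHom H : ComplexRepGroup H →+ ComplexRepGroup G) ↔
      ∀ h : H, conjugatesOf (h : G) ∩ (H : Set G) = Subtype.val '' conjugatesOf h) ∧
    (Function.Injective (inductionHom H : RealRepGroup H →+ RealRepGroup G) ↔
      ∀ h : H, realConjugatesOf (h : G) ∩ (H : Set G) = Subtype.val '' realConjugatesOf h) ∧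
    (H.Normal →
      (Function.Injective (inductionHom H : ComplexRepGroup H →+ ComplexRepGroup G) ↔
        ∀ h : H, conjugatesOf (h : G) = Subtype.val '' conjugatesOf h) ∧
      (Function.Injective (inductionHom H : RealRepGroup H →+ RealRepGroup G) ↔
        ∀ h : H, realConjugatesOf (h : G) = Subtype.val '' realConjugatesOf h)) := by
  refine ⟨complex_inductionHom_injective_iff H, real_inductionHom_injective_iff H, fun hN => ?_⟩
  constructor
  · rw [complex_inductionHom_injective_iff]
    simp only [Set.inter_eq_left.2 (conjugatesOf_subset_of_normal hN _)]
  · rw [real_inductionHom_injective_iff]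
    simp only [Set.inter_eq_left.2 (realConjugatesOf_subset_of_normal hN _)]
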